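/- Let $\mathcal H$ be a complex Hilbert space. A contraction is a bounded linear operator $T$ on $\mathcal H$ with $\|T\|\le 1$; its defect operator is $D_T=(I-T^*T)^{1/2}$ and its defect space is $\mathcal D_T=\overline{D_T\mathcal H}$. Write $\Re A=\tfrac12(A+A^*)$. For contractions $T,T'$ on $\mathcal H$: - $T$ is Harnack dominated by $T'$ if there is a constant $c\ge 1$ such that $\Re p(T)\le c\,\Re p(T')$ for every complex polynomial $p$ with $\Re p(z)\ge 0$ for all $|z|\le 1$; $T$ and $T'$ are Harnack equivalent if each is Harnack dominated by the other. - $T$ is Shmul'yan dominated by $T'$ if $T=T'+D_{T'^*}XD_{T'}$ for some bounded operator $X:\mathcal D_{T'}\to\mathcal D_{T'^*}$; $T$ and $T'$ are Shmul'yan equivalent if each is Shmul'yan dominated by the other. - $T$ and $T'$ are doubly commuting if $T$ commutes with $T'$ and with $T'^*$; $T$ is quasi-normal if $T$ commutes with $T^*T$. Let $T$ and $T'$ be doubly commuting contractions on $\mathcal H$ such that $T$ is quasi-normal and $T$ is Harnack dominated by $T'$. Then $T$ and $T'$ are Shmul'yan equivalent, and hence Harnack equivalent. In particular, if $T$ and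 $T'$ are commuting normal contractions on $\mathcal H$ and $T$ is Harnack dominated by $T'$, then $T$ and $T'$ are Shmul'yan equivalent, and hence Harnack equivalent. -/

import Mathlib

noncomputable section

open ContinuousLinearMap
open scoped ComplexStarModule

/-- `T` is Harnack dominated by `T'`: there is `c ≥ 1` such that `Re p(T) ≤ c Re p(T')` in the
Loewner order, for every complex polynomial `p` with `Re p ≥ 0` on the closed unit disc. Here
`ℜ A` is Mathlib's real part `(1/2)(A + A*)`. -/
def HarnackDominated {H : Type*} [NormedAddCommGroup H] [InnerProductSpace ℂ H] [CompleteSpace H]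
    (T T' : H →L[ℂ] H) : Prop :=
  ∃ c : ℝ, 1 ≤ c ∧ ∀ p : Polynomial ℂ, (∀ z : ℂ, ‖z‖ ≤ 1 → 0 ≤ (p.eval z).re) →
    (ℜ (Polynomial.aeval T p) : H →L[ℂ] H) ≤ c • (ℜ (Polynomial.aeval T' p) : H →L[ℂ] H)

/-- Harnack equivalence: Harnack domination in both directions. -/
def HarnackEquivalent {H : Type*} [NormedAddCommGroup H] [InnerProductSpace ℂ H] [CompleteSpace H]
    (T T' : H →L[ℂ] H) : Prop :=
  HarnackDominated T T' ∧ HarnackDominated T' T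

section Defect

variable {H₁ H₂ : Type*} [NormedAddCommGroup H₁] [InnerProductSpace ℂ H₁] [CompleteSpace H₁]
  [NormedAddCommGroup H₂] [InnerProductSpace ℂ H₂] [CompleteSpace H₂]

/-- The defect operator `D_T = (I - T* T)^{1/2}` (the positive square root; meant for `‖T‖ ≤ 1`). -/
def defectOp (T : H₁ →L[ℂ] H₂) : H₁ →L[ℂ] H₁ :=
  CFC.sqrt (1 - adjoint T ∘L T)

/-- The defect space of `T`: the closure of the range of `D_T`. -/
def defectSpace (T : H₁ →L[ℂ] H₂) : Submodule ℂ H₁ :=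
  (defectOp T).range.topologicalClosure

/-- The defect operator, viewed as an operator from the whole space into the defect space. -/
def defectOpTo (T : H₁ →L[ℂ] H₂) : H₁ →L[ℂ] defectSpace T :=
  (defectOp T).codRestrict (defectSpace T) fun x =>
    Submodule.le_topologicalClosure _ ⟨x, rfl⟩

/-- The defect operator, viewed as an operator from the defect space into the whole space. -/
def defectOpFrom (T : H₁ →L[ℂ] H₂) : defectSpace T →L[ℂ] H₁ :=
  defectOp T ∘L (defectSpace T).subtypeL

/-- `B` is Shmul'yan dominated by `A`: `B = A + D_{A*} X D_A` for some bounded operator `X` from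
the defect space of `A` to the defect space of `A*`. -/
def ShmulyanDominated (B A : H₁ →L[ℂ] H₂) : Prop :=
  ∃ X : defectSpace A →L[ℂ] defectSpace (adjoint A),
    B = A + defectOpFrom (adjoint A) ∘L X ∘L defectOpTo A

/-- Shmul'yan equivalence: Shmul'yan domination in both directions. -/
def ShmulyanEquivalent (A B : H₁ →L[ℂ] H₂) : Prop :=
  ShmulyanDominated A B ∧ ShmulyanDominated B A

end Defect

/-- `A` and `B` doubly commute: `A` commutes with `B` and with `B*`. -/
def DoublyCommute {H : Type*} [NormedAddCommGroup H] [InnerProductSpace ℂ H] [CompleteSpace H]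
    (A B : H →L[ℂ] H) : Prop :=
  Commute A B ∧ Commute A (adjoint B)

/-- `A` is quasi-normal: `A` commutes with `A* A`. -/
def IsQuasiNormal {H : Type*} [NormedAddCommGroup H] [InnerProductSpace ℂ H] [CompleteSpace H]
    (A : H →L[ℂ] H) : Prop :=
  Commute A (adjoint A * A)

end

open ContinuousLinearMap
open scoped ComplexStarModule

/-! ### Defect operators and Douglas factorization. -/

section Basics

/-! Everything is reduced to the scalar estimate |⟨(T' - T)x, y⟩| ≤ C ‖D_T x‖ ‖D_{T*} y‖, which by
two Douglas factorizations yields Shmul'yan domination (`shmulyanDominated_of_norm_inner_le`).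

Testing Harnack domination on truncated Poisson kernels and averaging over roots of unity gives an
inequality between the Toeplitz forms of rT and rT', r < 1 (`toeplitzForm_le`). Pairs of vectors
already give ‖D_T x‖ ≤ c ‖D_{T'} x‖, and likewise for the adjoints.

The decisive test is the orbit h_j = T^j u, with T, T' now strict contractions. Put Q = T*T and W =
T*T'. Quasi-normality and double commutation turn T*^i T'^{i-j} T^j into Q^j W^{i-j}, so the form
becomes a Cauchy product of geometric series and converges to an expression in (1 - Q)⁻¹ and (1 -
W)⁻¹. Choosing u = (1 - Q)(1 - W)x gives ‖(1 - W)x‖ ≤ 2c ‖(1 - Q)x‖ (`norm_one_sub_apply_le`). As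
D_T commutes with W, one factor D_T can be moved across the inner product, and a splitting of T' - T
gives the scalar estimate with C = 4c, uniformly in r; then r → 1.

The defect comparisons replace D_T, D_{T*} by those of T', which gives the other Shmul'yan
domination. The reverse Harnack domination follows by comparing the Poisson kernels of T and T'
through their resolvents (`norm_defectOp_resolvent_le`) and passing from Poisson kernels back to
polynomials (`re_sum_coeff_mul_nonneg`). -/

theorem norm_inner_self {H : Type*} [NormedAddCommGroup H] [InnerProductSpace ℂ H] (x : H) :
    ‖inner ℂ x x‖ = ‖x‖ ^ 2 := by
  rw [inner_self_eq_norm_sq_to_K, norm_pow]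
  simp

theorem norm_sq_sub_nonneg {H : Type*} [NormedAddCommGroup H] [InnerProductSpace ℂ H] {T : H →L[ℂ] H}
    (hT : ‖T‖ ≤ 1) (x : H) : 0 ≤ ‖x‖ ^ 2 - ‖T x‖ ^ 2 := by
  have := T.le_of_opNorm_le hT x
  have h0 := norm_nonneg (T x)
  nlinarith

variable {H : Type*} [NormedAddCommGroup H] [InnerProductSpace ℂ H] [CompleteSpace H]

theorem re_inner_realPart (A : H →L[ℂ] H) (x : H) :
    (inner ℂ x ((ℜ A : H →L[ℂ] H) x)).re = (inner ℂ x (A x)).re := by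
  have h : (inner ℂ x ((star A) x)).re = (inner ℂ x (A x)).re := by
    rw [star_eq_adjoint, adjoint_inner_right, ← inner_conj_symm, Complex.conj_re]
  rw [realPart_apply_coe]
  simp only [smul_apply, add_apply,
    inner_smul_right_eq_smul, inner_add_right, Complex.smul_re, Complex.add_re, h, smul_eq_mul]
  ring

theorem realPart_le_smul_realPart_iff (A B : H →L[ℂ] H) (c : ℝ) :
    (ℜ A : H →L[ℂ] H) ≤ c • (ℜ B : H →L[ℂ] H) ↔
      ∀ x, (inner ℂ x (A x)).re ≤ c * (inner ℂ x (B x)).re := by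
  have hsa : IsSelfAdjoint (c • (ℜ B : H →L[ℂ] H) - (ℜ A : H →L[ℂ] H)) :=
    (IsSelfAdjoint.smul (IsSelfAdjoint.all c) (ℜ B).2).sub (ℜ A).2
  rw [ContinuousLinearMap.le_def, isPositive_def']
  simp only [hsa, true_and]
  refine forall_congr' fun x => ?_
  rw [reApplyInnerSelf_apply, ← re_inner_realPart A, ← re_inner_realPart B, inner_re_symm]
  simp [inner_sub_right, inner_smul_right_eq_smul]

theorem re_inner_one_sub_adjoint_mul_self (T : H →L[ℂ] H) (x : H) :
    (inner ℂ x ((1 - adjoint T * T) x)).re = ‖x‖ ^ 2 - ‖T x‖ ^ 2 := by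
  simp only [sub_apply, one_apply_eq_self,
    mul_apply_eq_comp, inner_sub_right, adjoint_inner_right, Complex.sub_re]
  rw [← inner_self_eq_norm_sq (𝕜 := ℂ) x, ← inner_self_eq_norm_sq (𝕜 := ℂ) (T x)]
  rfl

theorem one_sub_adjoint_mul_self_nonneg {T : H →L[ℂ] H} (hT : ‖T‖ ≤ 1) :
    0 ≤ 1 - adjoint T * T := by
  rw [nonneg_iff_isPositive, isPositive_def']
  refine ⟨(IsSelfAdjoint.one _).sub (IsSelfAdjoint.star_mul_self T), fun x => ?_⟩
  rw [reApplyInnerSelf_apply, inner_re_symm]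
  exact (norm_sq_sub_nonneg hT x).trans_eq (re_inner_one_sub_adjoint_mul_self T x).symm

theorem defectOp_isSelfAdjoint (T : H →L[ℂ] H) : IsSelfAdjoint (defectOp T) :=
  (CFC.sqrt_nonneg _).isSelfAdjoint

theorem defectOp_inner (T : H →L[ℂ] H) (x y : H) :
    inner ℂ (defectOp T x) y = inner ℂ x (defectOp T y) := by
  conv_lhs => rw [← (defectOp_isSelfAdjoint T).adjoint_eq]
  rw [adjoint_inner_left]

theorem defectOp_mul_self {T : H →L[ℂ] H} (hT : ‖T‖ ≤ 1) :
    defectOp T * defectOp T = 1 - adjoint T * T :=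
  CFC.sqrt_mul_sqrt_self _ (one_sub_adjoint_mul_self_nonneg hT)

theorem defectOp_defectOp_apply {T : H →L[ℂ] H} (hT : ‖T‖ ≤ 1) (x : H) :
    defectOp T (defectOp T x) = x - adjoint T (T x) := by
  simpa using congrArg (fun A : H →L[ℂ] H => A x) (defectOp_mul_self hT)

theorem norm_defectOp_sq {T : H →L[ℂ] H} (hT : ‖T‖ ≤ 1) (x : H) :
    ‖defectOp T x‖ ^ 2 = ‖x‖ ^ 2 - ‖T x‖ ^ 2 := by
  rw [← re_inner_one_sub_adjoint_mul_self, ← defectOp_mul_self hT, mul_apply_eq_comp,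
    ← defectOp_inner, ← inner_self_eq_norm_sq (𝕜 := ℂ)]
  rfl

theorem norm_defectOp_le {T : H →L[ℂ] H} (hT : ‖T‖ ≤ 1) (x : H) : ‖defectOp T x‖ ≤ ‖x‖ := by
  rw [← sq_le_sq₀ (norm_nonneg _) (norm_nonneg _), norm_defectOp_sq hT]
  exact sub_le_self _ (sq_nonneg _)

theorem Commute.defectOp_right {T A : H →L[ℂ] H} (h : Commute A (adjoint T * T)) :
    Commute A (defectOp T) := by
  have : Commute A (1 - adjoint T * T) := (Commute.one_right A).sub_right h
  exact (this.symm.cfcₙ_nnreal _).symm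

/-- `‖D_{T*} T x‖ ≤ ‖D_T x‖`. -/
theorem norm_defectOp_adjoint_apply_le {T : H →L[ℂ] H} (hT : ‖T‖ ≤ 1) (x : H) :
    ‖defectOp (adjoint T) (T x)‖ ≤ ‖defectOp T x‖ := by
  have hT' : ‖adjoint T‖ ≤ 1 := by rwa [LinearIsometryEquiv.norm_map]
  rw [← sq_le_sq₀ (norm_nonneg _) (norm_nonneg _), norm_defectOp_sq hT', norm_defectOp_sq hT]
  have h1 : ‖x - adjoint T (T x)‖ ^ 2 = ‖x‖ ^ 2 - 2 * ‖T x‖ ^ 2 + ‖adjoint T (T x)‖ ^ 2 := by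
    rw [norm_sub_sq (𝕜 := ℂ), adjoint_inner_right, inner_self_eq_norm_sq (𝕜 := ℂ)]
  nlinarith [sq_nonneg ‖x - adjoint T (T x)‖]

instance (T : H →L[ℂ] H) : CompleteSpace (defectSpace T) :=
  (Submodule.isClosed_topologicalClosure _).completeSpace_coe

theorem denseRange_defectOpTo (T : H →L[ℂ] H) : DenseRange (defectOpTo T) := by
  intro y
  rw [Topology.IsInducing.subtypeVal.closure_eq_preimage_closure_image, Set.mem_preimage,
    ← Set.range_comp]
  exact y.2

theorem adjoint_defectOpTo (T : H →L[ℂ] H) : adjoint (defectOpTo T) = defectOpFrom T := by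
  symm
  rw [eq_adjoint_iff]
  intro x y
  exact defectOp_inner T x y

/-- Douglas factorization through the defect operator. -/
theorem exists_comp_defectOpTo_eq {F : Type*} [NormedAddCommGroup F] [NormedSpace ℂ F]
    [CompleteSpace F] (T : H →L[ℂ] H) (A : H →L[ℂ] F) (C : ℝ)
    (h : ∀ x, ‖A x‖ ≤ C * ‖defectOp T x‖) :
    ∃ X : defectSpace T →L[ℂ] F, X ∘L defectOpTo T = A :=
  ⟨(A : H →ₗ[ℂ] F).extendOfNorm (defectOpTo T : H →ₗ[ℂ] defectSpace T), by
    ext x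
    exact LinearMap.extendOfNorm_eq (e := (defectOpTo T : H →ₗ[ℂ] defectSpace T))
      (denseRange_defectOpTo T) ⟨C, h⟩ x⟩

/-- Douglas factorization is applied twice: to B - A, which splits off D_A on the right, then to the
adjoint of the resulting factor, which splits off D_{A*} on the left. Each norm bound comes from
testing the form at the image vector itself. -/
theorem shmulyanDominated_of_norm_inner_le {A B : H →L[ℂ] H} (hA : ‖A‖ ≤ 1) {C : ℝ} (hC : 0 ≤ C)
    (h : ∀ x y, ‖inner ℂ ((B - A) x) y‖ ≤ C * ‖defectOp A x‖ * ‖defectOp (adjoint A) y‖) :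
    ShmulyanDominated B A := by
  have hA' : ‖adjoint A‖ ≤ 1 := by rwa [LinearIsometryEquiv.norm_map]
  obtain ⟨X, hX⟩ := exists_comp_defectOpTo_eq A (B - A) C fun x => by
    rcases (norm_nonneg ((B - A) x)).eq_or_lt with h0 | h0
    · rw [← h0]; positivity
    · have h1 := (h x ((B - A) x)).trans
        (mul_le_mul_of_nonneg_left (norm_defectOp_le hA' _) (by positivity))
      rw [norm_inner_self] at h1
      nlinarith
  have hXb : ∀ (v : defectSpace A) (y : H), ‖inner ℂ (X v) y‖ ≤ C * ‖v‖ * ‖defectOp (adjoint A) y‖ := by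
    intro v y
    refine (denseRange_defectOpTo A).induction_on v
      (isClosed_le (by fun_prop) (by fun_prop)) fun x => ?_
    rw [← ContinuousLinearMap.comp_apply, hX]
    exact h x y
  obtain ⟨Y, hY⟩ := exists_comp_defectOpTo_eq (adjoint A) (adjoint X) C fun y => by
    rcases (norm_nonneg (adjoint X y)).eq_or_lt with h0 | h0
    · rw [← h0]; positivity
    · have h1 := hXb (adjoint X y) y
      rw [← adjoint_inner_right, norm_inner_self] at h1
      nlinarith
  refine ⟨adjoint Y, ?_⟩
  have hX' : defectOpFrom (adjoint A) ∘L adjoint Y = X := by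
    rw [← adjoint_defectOpTo, ← adjoint_comp, hY, adjoint_adjoint]
  rw [← ContinuousLinearMap.comp_assoc, hX', hX]
  abel

end Basics

/-! ### Averages over roots of unity and Poisson kernels. -/

section Averaging

open Finset

theorem sum_pow_mul_conj_pow {M : ℕ} {ω : ℂ} (hω : IsPrimitiveRoot ω M) (hM : M ≠ 0) {a b : ℕ}
    (ha : a < M) (hb : b < M) :
    ∑ k ∈ range M, (ω ^ k) ^ a * (starRingEnd ℂ (ω ^ k)) ^ b = if a = b then (M : ℂ) else 0 := by
  have hn : ‖ω‖ = 1 := hω.norm'_eq_one hM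
  have h0 : ω ≠ 0 := by rintro rfl; simp at hn
  have hconj : starRingEnd ℂ ω = ω⁻¹ := (Complex.inv_eq_conj hn).symm
  have hterm : ∀ k, (ω ^ k) ^ a * (starRingEnd ℂ (ω ^ k)) ^ b = (ω ^ a * (ω ^ b)⁻¹) ^ k := by
    intro k
    rw [map_pow, hconj]
    simp only [mul_pow, inv_pow, ← pow_mul]
    rw [mul_comm a k, mul_comm b k]
  simp only [hterm]
  split_ifs with hab
  · subst hab
    simp [h0]
  · set ζ := ω ^ a * (ω ^ b)⁻¹ with hζ
    have hζ1 : ζ ≠ 1 := by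
      intro h
      rw [hζ, mul_inv_eq_one₀ (pow_ne_zero _ h0)] at h
      exact hab (hω.pow_inj ha hb h)
    have hζM : ζ ^ M = 1 := by
      rw [hζ, mul_pow, inv_pow, ← pow_mul, ← pow_mul, mul_comm a, mul_comm b, pow_mul, pow_mul,
        hω.pow_eq_one]
      simp
    have := mul_neg_geom_sum ζ M
    rw [hζM, sub_self] at this
    exact (mul_eq_zero.mp this).resolve_left (sub_ne_zero.mpr hζ1.symm)

theorem norm_root_pow {M : ℕ} {ω : ℂ} (hω : IsPrimitiveRoot ω M) (hM : M ≠ 0) (k : ℕ) :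
    ‖ω ^ k‖ = 1 := by
  rw [norm_pow, hω.norm'_eq_one hM, one_pow]

/-- If two trigonometric polynomials `Re ∑ aₙ z̄ⁿ` and `Re ∑ bₙ zⁿ` are nonnegative on the unit
circle, then so is the mean of their product. -/
theorem re_sum_mul_add_nonneg {N : ℕ} (a b : ℕ → ℂ)
    (ha : ∀ z : ℂ, ‖z‖ = 1 → 0 ≤ (∑ n ∈ range (N + 1), a n * z ^ n).re)
    (hb : ∀ z : ℂ, ‖z‖ = 1 → 0 ≤ (∑ n ∈ range (N + 1), b n * z ^ n).re) :
    0 ≤ (∑ n ∈ range (N + 1), a n * b n).re + (starRingEnd ℂ (a 0) * b 0).re := by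
  -- Exponents m + n reach 2N, so with 2N + 1 nodes only m = n = 0 survives in the second average.
  set M := 2 * N + 1 with hM
  have hM0 : M ≠ 0 := by omega
  obtain ⟨ω, hω⟩ : ∃ ω : ℂ, IsPrimitiveRoot ω M := ⟨_, Complex.isPrimitiveRoot_exp M hM0⟩
  set A : ℂ → ℂ := fun z => ∑ n ∈ range (N + 1), a n * z ^ n
  set B : ℂ → ℂ := fun z => ∑ n ∈ range (N + 1), b n * z ^ n
  have h1 : ∑ k ∈ range M, A (starRingEnd ℂ (ω ^ k)) * B (ω ^ k)
      = M * ∑ n ∈ range (N + 1), a n * b n := by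
    calc _ = ∑ m ∈ range (N + 1), ∑ n ∈ range (N + 1), a m * b n *
          ∑ k ∈ range M, (ω ^ k) ^ n * (starRingEnd ℂ (ω ^ k)) ^ m := by
          simp only [A, B, sum_mul_sum]
          simp only [mul_sum]
          rw [sum_comm]
          refine sum_congr rfl fun m _ => ?_
          rw [sum_comm]
          refine sum_congr rfl fun n _ => sum_congr rfl fun k _ => by ring
      _ = ∑ m ∈ range (N + 1), ∑ n ∈ range (N + 1), a m * b n * if n = m then (M : ℂ) else 0 := by
          refine sum_congr rfl fun m hm => sum_congr rfl fun n hn => ?_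
          rw [mem_range] at hm hn
          rw [sum_pow_mul_conj_pow hω hM0 (by omega) (by omega)]
      _ = _ := by
          rw [mul_sum]
          refine sum_congr rfl fun m hm => ?_
          simp only [mul_ite, mul_zero, sum_ite_eq', hm, if_true]
          ring
  have h2 : ∑ k ∈ range M, starRingEnd ℂ (A (starRingEnd ℂ (ω ^ k))) * B (ω ^ k)
      = M * (starRingEnd ℂ (a 0) * b 0) := by
    calc _ = ∑ m ∈ range (N + 1), ∑ n ∈ range (N + 1), starRingEnd ℂ (a m) * b n *
          ∑ k ∈ range M, (ω ^ k) ^ (m + n) * (starRingEnd ℂ (ω ^ k)) ^ 0 := by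
          simp only [A, B, map_sum, map_mul, map_pow (starRingEnd ℂ), Complex.conj_conj,
            sum_mul_sum]
          simp only [mul_sum]
          rw [sum_comm]
          refine sum_congr rfl fun m _ => ?_
          rw [sum_comm]
          refine sum_congr rfl fun n _ => sum_congr rfl fun k _ => by ring
      _ = ∑ m ∈ range (N + 1), ∑ n ∈ range (N + 1),
          starRingEnd ℂ (a m) * b n * if m + n = 0 then (M : ℂ) else 0 := by
          refine sum_congr rfl fun m hm => sum_congr rfl fun n hn => ?_
          rw [mem_range] at hm hn
          rw [sum_pow_mul_conj_pow hω hM0 (by omega) (by omega)]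
      _ = _ := by
          rw [sum_eq_single 0, sum_eq_single 0]
          · simp; ring
          · intro n _ hn; simp [hn]
          · simp
          · intro m _ hm
            exact sum_eq_zero fun n _ => by simp [hm]
          · simp
  have h3 : 0 ≤ ∑ k ∈ range M, (A (starRingEnd ℂ (ω ^ k)) * B (ω ^ k) +
      starRingEnd ℂ (A (starRingEnd ℂ (ω ^ k))) * B (ω ^ k)).re := by
    refine sum_nonneg fun k _ => ?_
    have hA := ha (starRingEnd ℂ (ω ^ k)) (by rw [Complex.norm_conj, norm_root_pow hω hM0])
    have hB := hb (ω ^ k) (norm_root_pow hω hM0 k)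
    have : (A (starRingEnd ℂ (ω ^ k)) * B (ω ^ k) +
      starRingEnd ℂ (A (starRingEnd ℂ (ω ^ k))) * B (ω ^ k)).re =
        2 * ((A (starRingEnd ℂ (ω ^ k))).re * (B (ω ^ k)).re) := by
      simp only [Complex.add_re, Complex.mul_re, Complex.conj_re, Complex.conj_im]
      ring
    rw [this]
    exact mul_nonneg zero_le_two (mul_nonneg hA hB)
  rw [← Complex.re_sum, sum_add_distrib, h1, h2, ← mul_add, ← Complex.ofReal_natCast,
    Complex.re_ofReal_mul, Complex.add_re] at h3
  exact nonneg_of_mul_nonneg_right h3 (by positivity)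

theorem continuous_le_of_lt_one {f g : ℝ → ℝ} (hf : Continuous f) (hg : Continuous g)
    (h : ∀ r, 0 < r → r < 1 → f r ≤ g r) : f 1 ≤ g 1 := by
  have hcl : (1 : ℝ) ∈ closure (Set.Ioo (0 : ℝ) 1) := by
    rw [closure_Ioo (by norm_num)]; simp
  exact closure_minimal (fun r hr => h r hr.1 hr.2) (isClosed_le hf hg) hcl

theorem tendsto_two_mul_pow_div {r B : ℝ} (h0 : 0 ≤ r) (h1 : r < 1) :
    Filter.Tendsto (fun N : ℕ => 2 * (B * r ^ (N + 1) / (1 - r))) Filter.atTop (nhds 0) := by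
  have h := ((tendsto_pow_atTop_nhds_zero_of_lt_one h0 h1).comp (Filter.tendsto_add_atTop_nat 1))
  simpa using ((h.const_mul B).div_const (1 - r)).const_mul 2

/-- A bounded sequence `t` whose Poisson sums `Re (2 ∑ zⁿ tₙ - t₀)` are nonnegative on the open
disc pairs nonnegatively with every polynomial of nonnegative real part. -/
theorem re_sum_coeff_mul_nonneg {t : ℕ → ℂ} {B : ℝ} (hB : ∀ n, ‖t n‖ ≤ B) (ht0 : (t 0).im = 0)
    (ht : ∀ z : ℂ, ‖z‖ < 1 → ∀ s, HasSum (fun n => z ^ n * t n) s → 0 ≤ (2 * s - t 0).re)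
    (p : Polynomial ℂ) (hp : ∀ z : ℂ, ‖z‖ ≤ 1 → 0 ≤ (p.eval z).re) :
    0 ≤ (∑ n ∈ range (p.natDegree + 1), p.coeff n * t n).re := by
  have hB0 : 0 ≤ B := (norm_nonneg _).trans (hB 0)
  have key : ∀ r : ℝ, 0 < r → r < 1 →
      0 ≤ (∑ n ∈ range (p.natDegree + 1), p.coeff n * ((r : ℂ) ^ n * t n)).re := by
    intro r hr0 hr1
    have hfin : ∀ N ≥ p.natDegree, 0 ≤ (∑ n ∈ range (p.natDegree + 1),
        p.coeff n * ((r : ℂ) ^ n * t n)).re + 2 * (B * r ^ (N + 1) / (1 - r)) * (p.coeff 0).re := by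
      intro N hN
      set ε := 2 * (B * r ^ (N + 1) / (1 - r)) with hε
      -- Coefficients of the Poisson sum 2 ∑ (rz)ⁿ tₙ - t₀ truncated at N; ε is twice the geometric
      -- bound on the tail and restores nonnegativity.
      set b : ℕ → ℂ := fun n => 2 * ((r : ℂ) ^ n * t n) + if n = 0 then (ε - t 0 : ℂ) else 0
        with hb
      have hsum : ∀ n ≥ p.natDegree, ∀ f : ℕ → ℂ,
          ∑ k ∈ range (n + 1), p.coeff k * f k
            = ∑ k ∈ range (p.natDegree + 1), p.coeff k * f k := by
        intro n hn f
        symm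
        refine sum_subset (range_subset_range.mpr (by omega)) fun k _ hk => ?_
        rw [p.coeff_eq_zero_of_natDegree_lt (by simpa using hk), zero_mul]
      have h := re_sum_mul_add_nonneg (N := N) p.coeff b ?_ ?_
      · have e1 : ∑ n ∈ range (N + 1), p.coeff n * b n =
            2 * ∑ n ∈ range (p.natDegree + 1), p.coeff n * ((r : ℂ) ^ n * t n)
              + p.coeff 0 * (ε - t 0) := by
          simp only [hb, mul_add, sum_add_distrib, mul_ite, mul_zero]
          rw [sum_ite_eq' (range (N + 1)) 0 (fun n => p.coeff n * ((ε : ℂ) - t 0)),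
            if_pos (by simp), ← hsum N hN, mul_sum]
          congr 1
          exact sum_congr rfl fun n _ => by ring
        have e2 : b 0 = t 0 + ε := by simp [hb]; ring
        rw [e1, e2] at h
        simp only [Complex.add_re, Complex.mul_re, Complex.sub_re, Complex.sub_im, Complex.add_im,
          Complex.ofReal_re, Complex.ofReal_im, Complex.conj_re, Complex.conj_im, ht0,
          Complex.re_ofNat, Complex.im_ofNat] at h
        linarith
      · intro z hz
        rw [hsum N hN, ← Polynomial.eval_eq_sum_range]
        exact hp z hz.le
      · intro z hz
        have hrz : ‖(r : ℂ) * z‖ = r := by rw [norm_mul, hz]; simp [abs_of_pos hr0]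
        have hbound : ∀ n, ‖((r : ℂ) * z) ^ n * t n‖ ≤ B * r ^ n := by
          intro n
          rw [norm_mul, norm_pow, hrz, mul_comm]
          exact mul_le_mul_of_nonneg_right (hB n) (by positivity)
        have hs : Summable fun n => ((r : ℂ) * z) ^ n * t n :=
          Summable.of_norm_bounded ((summable_geometric_of_lt_one hr0.le hr1).mul_left B) hbound
        obtain ⟨s, hs⟩ := hs
        have hpos := ht (r * z) (by rw [hrz]; exact hr1) s hs
        have hd := dist_le_of_le_geometric_of_tendsto (f := fun N => ∑ n ∈ range N,
          ((r : ℂ) * z) ^ n * t n) r B hr1 (fun n => by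
            rw [sum_range_succ, dist_self_add_right]; exact hbound n) hs.tendsto_sum_nat (N + 1)
        rw [dist_eq_norm] at hd
        have hre := (Complex.abs_re_le_norm _).trans hd
        have e3 : ∑ n ∈ range (N + 1), b n * z ^ n =
            2 * ∑ n ∈ range (N + 1), ((r : ℂ) * z) ^ n * t n + (ε - t 0) := by
          simp only [hb, add_mul, sum_add_distrib, ite_mul, zero_mul]
          rw [sum_ite_eq' (range (N + 1)) 0 (fun n => ((ε : ℂ) - t 0) * z ^ n),
            if_pos (by simp), mul_sum]
          congr 1
          · exact sum_congr rfl fun n _ => by ring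
          · simp
        rw [e3]
        simp only [Complex.add_re, Complex.mul_re, Complex.sub_re,
          Complex.ofReal_re, Complex.re_ofNat, Complex.im_ofNat, zero_mul, sub_zero] at hpos hre ⊢
        have := (abs_le.mp hre).1
        linarith
    have hlim := (((tendsto_two_mul_pow_div (B := B) hr0.le hr1).mul_const (p.coeff 0).re).const_add
      (∑ n ∈ range (p.natDegree + 1), p.coeff n * ((r : ℂ) ^ n * t n)).re)
    rw [zero_mul, add_zero] at hlim
    exact ge_of_tendsto hlim (Filter.eventually_atTop.mpr ⟨_, hfin⟩)
  have := continuous_le_of_lt_one (f := fun _ => 0) (g := fun r : ℝ =>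
    (∑ n ∈ range (p.natDegree + 1), p.coeff n * ((r : ℂ) ^ n * t n)).re) continuous_const
    (by fun_prop) key
  simpa using this

/-- The truncated Poisson kernel, corrected by a small constant, has nonnegative real part. -/
theorem re_poisson_truncation_nonneg {r : ℝ} (hr0 : 0 < r) (hr1 : r < 1) (N : ℕ) {w : ℂ}
    (hw : ‖w‖ ≤ 1) :
    0 ≤ (2 * ∑ n ∈ range (N + 1), ((r : ℂ) * w) ^ n
      + ((2 * (1 * r ^ (N + 1) / (1 - r)) : ℝ) - 1)).re := by
  set u : ℂ := r * w with hu
  have hun : ‖u‖ ≤ r := by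
    rw [hu, norm_mul, Complex.norm_real, Real.norm_of_nonneg hr0.le]
    exact mul_le_of_le_one_right hr0.le hw
  have hd := dist_le_of_le_geometric_of_tendsto (f := fun N => ∑ n ∈ range N, u ^ n) r 1 hr1
    (fun n => by
      rw [sum_range_succ, dist_self_add_right, norm_pow, one_mul]
      exact pow_le_pow_left₀ (norm_nonneg _) hun n)
    (hasSum_geometric_of_norm_lt_one (hun.trans_lt hr1)).tendsto_sum_nat (N + 1)
  rw [dist_eq_norm] at hd
  have hre := (abs_le.mp ((Complex.abs_re_le_norm _).trans hd)).1
  -- This is the scalar Poisson kernel (1 - |u|²) / |1 - u|².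
  have hpos : 0 ≤ 2 * ((1 - u)⁻¹).re - 1 := by
    have hne : 0 < Complex.normSq (1 - u) := by
      rw [Complex.normSq_pos, sub_ne_zero]
      rintro h
      rw [← h] at hun
      simp at hun; linarith
    have hnu : Complex.normSq u ≤ 1 := by
      rw [Complex.normSq_eq_norm_sq]
      nlinarith [norm_nonneg u]
    rw [Complex.inv_re, ← mul_div_assoc, sub_nonneg, le_div_iff₀ hne]
    simp only [Complex.normSq_apply, Complex.sub_re, Complex.sub_im, Complex.one_re,
      Complex.one_im] at hnu ⊢
    nlinarith
  simp only [Complex.add_re, Complex.mul_re, Complex.sub_re, Complex.ofReal_re, Complex.re_ofNat,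
    Complex.im_ofNat, zero_mul, sub_zero, Complex.one_re] at hre ⊢
  linarith

end Averaging

/-! ### From Harnack domination to Toeplitz forms. -/

section Toeplitz

open Finset

variable {H : Type*} [NormedAddCommGroup H] [InnerProductSpace ℂ H]

theorem sum_range_antidiagonal {E : Type*} [AddCommMonoid E] {N i L : ℕ} (hi : i < L) (hN : L ≤ N)
    (f : ℕ → ℕ → E) :
    ∑ n ∈ range (N + 1), ∑ j ∈ range L, (if n + j = i then f n j else 0)
      = ∑ j ∈ range (i + 1), f (i - j) j := by
  rw [sum_comm]
  rw [← sum_subset (range_subset_range.mpr (show i + 1 ≤ L by omega))]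
  · refine sum_congr rfl fun j hj => ?_
    rw [mem_range] at hj
    rw [sum_eq_single (i - j)]
    · rw [if_pos (by omega)]
    · intro n _ hn
      rw [if_neg (by omega)]
    · intro h
      rw [mem_range] at h
      omega
  · intro j _ hj
    rw [mem_range] at hj
    exact sum_eq_zero fun n _ => by rw [if_neg (by omega)]

/-- Averaging over the rotations ω^k keeps only the terms with n + j = i. No aliasing occurs since n
+ j < N + L < M, and L ≤ N ensures that every difference i - j is among the available degrees. -/
theorem sum_inner_average {M N L : ℕ} (hM : M = N + L + 1) (hN : L ≤ N) {ω : ℂ}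
    (hω : IsPrimitiveRoot ω M) (X : H →L[ℂ] H) (b : ℕ → ℂ) (h : ℕ → H) :
    ∑ k ∈ range M, inner ℂ (∑ i ∈ range L, (ω ^ k) ^ i • h i)
      ((∑ n ∈ range (N + 1), (b n * (ω ^ k) ^ n) • X ^ n) (∑ j ∈ range L, (ω ^ k) ^ j • h j))
      = M * ∑ i ∈ range L, ∑ j ∈ range (i + 1), b (i - j) * inner ℂ (h i) ((X ^ (i - j)) (h j)) := by
  have hM0 : M ≠ 0 := by omega
  calc _ = ∑ k ∈ range M, ∑ i ∈ range L, ∑ n ∈ range (N + 1), ∑ j ∈ range L,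
        b n * inner ℂ (h i) ((X ^ n) (h j)) *
          ((ω ^ k) ^ (n + j) * (starRingEnd ℂ (ω ^ k)) ^ i) := by
        refine sum_congr rfl fun k _ => ?_
        rw [sum_inner]
        refine sum_congr rfl fun i _ => ?_
        rw [_root_.sum_apply, inner_sum]
        refine sum_congr rfl fun n _ => ?_
        rw [map_sum, inner_sum]
        refine sum_congr rfl fun j _ => ?_
        rw [smul_apply, map_smul, inner_smul_left, inner_smul_right, inner_smul_right, map_pow,
          pow_add]
        ring
    _ = ∑ i ∈ range L, ∑ n ∈ range (N + 1), ∑ j ∈ range L, b n * inner ℂ (h i) ((X ^ n) (h j)) *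
          ∑ k ∈ range M, ((ω ^ k) ^ (n + j) * (starRingEnd ℂ (ω ^ k)) ^ i) := by
        simp only [mul_sum]
        rw [sum_comm]
        refine sum_congr rfl fun i _ => ?_
        rw [sum_comm]
        refine sum_congr rfl fun n _ => ?_
        rw [sum_comm]
    _ = ∑ i ∈ range L, ∑ n ∈ range (N + 1), ∑ j ∈ range L,
          if n + j = i then M * (b n * inner ℂ (h i) ((X ^ n) (h j))) else 0 := by
        refine sum_congr rfl fun i hi => sum_congr rfl fun n hn => sum_congr rfl fun j hj => ?_
        rw [mem_range] at hi hn hj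
        rw [sum_pow_mul_conj_pow hω hM0 (by omega) (by omega), mul_ite, mul_zero, mul_comm]
    _ = _ := by
        rw [mul_sum]
        refine sum_congr rfl fun i hi => ?_
        rw [mem_range] at hi
        rw [sum_range_antidiagonal hi hN (fun n j => (M : ℂ) * (b n * inner ℂ (h i) ((X ^ n) (h j)))),
          mul_sum]

/-- The quadratic form of the Toeplitz matrix with entries `X ^ (i - j)` below the diagonal and
their adjoints above it, evaluated at the first `L` vectors of `h`. -/
noncomputable def toeplitzForm (X : H →L[ℂ] H) (h : ℕ → H) (L : ℕ) : ℝ :=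
  ∑ i ∈ range L, (2 * (inner ℂ (h i) (∑ j ∈ range (i + 1), (X ^ (i - j)) (h j))).re - ‖h i‖ ^ 2)

theorem re_sum_poisson_coeff (X : H →L[ℂ] H) (h : ℕ → H) (L : ℕ) (r ε : ℝ) :
    (∑ i ∈ range L, ∑ j ∈ range (i + 1),
      (2 * (r : ℂ) ^ (i - j) + if i - j = 0 then ((ε : ℂ) - 1) else 0) *
        inner ℂ (h i) ((X ^ (i - j)) (h j))).re
      = toeplitzForm ((r : ℂ) • X) h L + ε * ∑ i ∈ range L, ‖h i‖ ^ 2 := by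
  rw [toeplitzForm, mul_sum, ← sum_add_distrib, Complex.re_sum]
  refine sum_congr rfl fun i _ => ?_
  have h1 : ∀ j ∈ range (i + 1),
      (2 * (r : ℂ) ^ (i - j) + if i - j = 0 then ((ε : ℂ) - 1) else 0) *
        inner ℂ (h i) ((X ^ (i - j)) (h j)) =
      2 * inner ℂ (h i) ((((r : ℂ) • X) ^ (i - j)) (h j)) +
        if j = i then ((ε : ℂ) - 1) * (‖h i‖ ^ 2 : ℝ) else 0 := by
    intro j hj
    rw [mem_range] at hj
    rw [smul_pow, smul_apply, inner_smul_right]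
    by_cases hij : j = i
    · subst hij
      rw [Nat.sub_self, if_pos rfl, if_pos rfl]
      simp only [pow_zero, one_apply_eq_self]
      rw [inner_self_eq_norm_sq_to_K]
      push_cast
      simp
      ring
    · rw [if_neg (by omega), if_neg hij]
      ring
  rw [sum_congr rfl h1, sum_add_distrib, sum_ite_eq', if_pos (by simp), ← mul_sum, ← inner_sum]
  simp only [Complex.add_re, Complex.mul_re, Complex.sub_re, Complex.ofReal_re, Complex.re_ofNat,
    Complex.im_ofNat, zero_mul, sub_zero, Complex.one_re, Complex.ofReal_im, mul_zero]
  ring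

theorem toeplitzForm_le {T T' : H →L[ℂ] H} {c : ℝ}
    (hc : ∀ p : Polynomial ℂ, (∀ z : ℂ, ‖z‖ ≤ 1 → 0 ≤ (p.eval z).re) → ∀ x,
      (inner ℂ x (Polynomial.aeval T p x)).re ≤ c * (inner ℂ x (Polynomial.aeval T' p x)).re)
    {r : ℝ} (hr0 : 0 < r) (hr1 : r < 1) (h : ℕ → H) (L : ℕ) :
    toeplitzForm ((r : ℂ) • T) h L ≤ c * toeplitzForm ((r : ℂ) • T') h L := by
  have hfin : ∀ N ≥ L, toeplitzForm ((r : ℂ) • T) h L +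
      2 * (1 * r ^ (N + 1) / (1 - r)) * ∑ i ∈ range L, ‖h i‖ ^ 2 ≤
      c * (toeplitzForm ((r : ℂ) • T') h L +
        2 * (1 * r ^ (N + 1) / (1 - r)) * ∑ i ∈ range L, ‖h i‖ ^ 2) := by
    intro N hN
    set ε := 2 * (1 * r ^ (N + 1) / (1 - r)) with hε
    set b : ℕ → ℂ := fun n => 2 * (r : ℂ) ^ n + if n = 0 then ((ε : ℂ) - 1) else 0 with hb
    obtain ⟨M, hM⟩ : ∃ M, M = N + L + 1 := ⟨_, rfl⟩
    have hM0 : M ≠ 0 := by omega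
    obtain ⟨ω, hω⟩ : ∃ ω : ℂ, IsPrimitiveRoot ω M := ⟨_, Complex.isPrimitiveRoot_exp M hM0⟩
    -- The corrected Poisson truncation, rotated by ω^k; it is tested at the vector ∑ (ω^k)^i h_i.
    let p : ℕ → Polynomial ℂ := fun k =>
      ∑ n ∈ range (N + 1), Polynomial.C (b n * (ω ^ k) ^ n) * Polynomial.X ^ n
    have haeval : ∀ (S : H →L[ℂ] H) k, Polynomial.aeval S (p k) =
        ∑ n ∈ range (N + 1), (b n * (ω ^ k) ^ n) • S ^ n := by
      intro S k
      simp only [p]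
      rw [map_sum]
      refine sum_congr rfl fun n _ => ?_
      rw [map_mul, Polynomial.aeval_C, Polynomial.aeval_X_pow, ← Algebra.smul_def]
    have hp : ∀ k, ∀ z : ℂ, ‖z‖ ≤ 1 → 0 ≤ ((p k).eval z).re := by
      intro k z hz
      have hw : ‖ω ^ k * z‖ ≤ 1 := by rw [norm_mul, norm_root_pow hω hM0, one_mul]; exact hz
      have := re_poisson_truncation_nonneg hr0 hr1 N hw
      rw [← hε] at this
      refine this.trans_eq (congrArg Complex.re ?_)
      simp only [p, Polynomial.eval_finsetSum, Polynomial.eval_mul, Polynomial.eval_pow,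
        Polynomial.eval_X, Polynomial.eval_C, hb, add_mul, sum_add_distrib, ite_mul, zero_mul]
      rw [sum_ite_eq' (range (N + 1)) 0 (fun n => ((ε : ℂ) - 1) * (ω ^ k) ^ n * z ^ n),
        if_pos (by simp), mul_sum]
      congr 1
      · exact sum_congr rfl fun n _ => by ring
      · simp
    have hsum := sum_le_sum fun k (_ : k ∈ range M) =>
      hc (p k) (hp k) (∑ i ∈ range L, (ω ^ k) ^ i • h i)
    simp only [haeval] at hsum
    rw [← mul_sum, ← Complex.re_sum, ← Complex.re_sum, sum_inner_average hM hN hω,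
      sum_inner_average hM hN hω, ← Complex.ofReal_natCast, Complex.re_ofReal_mul,
      Complex.re_ofReal_mul, re_sum_poisson_coeff, re_sum_poisson_coeff, mul_left_comm] at hsum
    exact le_of_mul_le_mul_left hsum (by positivity)
  have hlim := (tendsto_two_mul_pow_div (B := 1) hr0.le hr1).mul_const (∑ i ∈ range L, ‖h i‖ ^ 2)
  rw [zero_mul] at hlim
  have := le_of_tendsto_of_tendsto (hlim.const_add (toeplitzForm ((r : ℂ) • T) h L))
    ((hlim.const_add (toeplitzForm ((r : ℂ) • T') h L)).const_mul c)
    (Filter.eventually_atTop.mpr ⟨L, hfin⟩)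
  simpa using this

end Toeplitz

/-! ### Bounding T' - T for strict contractions. -/

section StrictContractions

open Finset Filter

variable {H : Type*} [NormedAddCommGroup H] [InnerProductSpace ℂ H] [CompleteSpace H]

theorem re_inner_self_eq {H : Type*} [NormedAddCommGroup H] [InnerProductSpace ℂ H] (x : H) :
    (inner ℂ x x).re = ‖x‖ ^ 2 :=
  inner_self_eq_norm_sq (𝕜 := ℂ) x

theorem re_inner_comm {H : Type*} [NormedAddCommGroup H] [InnerProductSpace ℂ H] (x y : H) :
    (inner ℂ x y).re = (inner ℂ y x).re :=
  inner_re_symm (𝕜 := ℂ) x y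

theorem re_inner_le_norm_mul {H : Type*} [NormedAddCommGroup H] [InnerProductSpace ℂ H] (x y : H) :
    (inner ℂ x y).re ≤ ‖x‖ * ‖y‖ :=
  re_inner_le_norm (𝕜 := ℂ) x y

theorem norm_sub_sq_re {H : Type*} [NormedAddCommGroup H] [InnerProductSpace ℂ H] (x y : H) :
    ‖x - y‖ ^ 2 = ‖x‖ ^ 2 - 2 * (inner ℂ x y).re + ‖y‖ ^ 2 :=
  norm_sub_sq (𝕜 := ℂ) x y

theorem toeplitzForm_two {H : Type*} [NormedAddCommGroup H] [InnerProductSpace ℂ H]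
    (X : H →L[ℂ] H) (x y : H) :
    toeplitzForm X (fun i => if i = 0 then x else y) 2 =
      ‖x‖ ^ 2 + ‖y‖ ^ 2 + 2 * (inner ℂ y (X x)).re := by
  simp only [toeplitzForm, sum_range_succ, sum_range_zero, zero_add, if_true, Nat.sub_self,
    pow_zero, one_apply_eq_self, one_ne_zero, if_false, Nat.sub_zero, pow_one, inner_add_right,
    inner_zero_right, Complex.zero_re, Complex.add_re, re_inner_self_eq]
  ring

theorem defect_add_sub_le_of_toeplitzForm_le {H : Type*} [NormedAddCommGroup H]
    [InnerProductSpace ℂ H] {S S' : H →L[ℂ] H} {c : ℝ}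
    (h : ∀ h L, toeplitzForm S h L ≤ c * toeplitzForm S' h L) (x : H) :
    (‖x‖ ^ 2 - ‖S x‖ ^ 2) + ‖(S - S') x‖ ^ 2 ≤ c * (‖x‖ ^ 2 - ‖S' x‖ ^ 2) := by
  -- The second vector minimizes the form of S', leaving exactly ‖x‖² - ‖S'x‖².
  have h1 := h (fun i => if i = 0 then x else - S' x) 2
  rw [toeplitzForm_two, toeplitzForm_two, norm_neg, inner_neg_left, inner_neg_left, Complex.neg_re,
    Complex.neg_re, re_inner_self_eq] at h1
  rw [sub_apply, norm_sub_sq_re, re_inner_comm]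
  linarith

theorem adjoint_defect_add_sub_le_of_toeplitzForm_le {S S' : H →L[ℂ] H} {c : ℝ}
    (h : ∀ h L, toeplitzForm S h L ≤ c * toeplitzForm S' h L) (y : H) :
    (‖y‖ ^ 2 - ‖adjoint S y‖ ^ 2) + ‖adjoint S y - adjoint S' y‖ ^ 2 ≤
      c * (‖y‖ ^ 2 - ‖adjoint S' y‖ ^ 2) := by
  have h1 := h (fun i => if i = 0 then - adjoint S' y else y) 2
  rw [toeplitzForm_two, toeplitzForm_two, norm_neg, map_neg, map_neg, inner_neg_right,
    inner_neg_right, Complex.neg_re, Complex.neg_re, ← adjoint_inner_left S,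
    ← adjoint_inner_left S', re_inner_self_eq] at h1
  rw [norm_sub_sq_re]
  linarith

theorem adjoint_pow_mul_pow_of_isQuasiNormal {T : H →L[ℂ] H} (hT : IsQuasiNormal T) (n : ℕ) :
    adjoint T ^ n * T ^ n = (adjoint T * T) ^ n := by
  induction n with
  | zero => simp
  | succ n ih =>
    rw [pow_succ' (adjoint T), pow_succ T, mul_assoc, ← mul_assoc (adjoint T ^ n), ih,
      ← (hT.pow_right n).eq, ← mul_assoc, ← pow_succ']

theorem IsQuasiNormal.adjoint_commute {T : H →L[ℂ] H} (hT : IsQuasiNormal T) :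
    Commute (adjoint T * T) (adjoint T) := by
  have h := (Commute.star_star hT).symm
  rwa [star_mul, star_eq_adjoint, star_eq_adjoint, adjoint_adjoint] at h

theorem inner_pow_apply_left (T : H →L[ℂ] H) (i : ℕ) (u v : H) :
    inner ℂ ((T ^ i) u) v = inner ℂ u ((adjoint T ^ i) v) := by
  rw [← star_eq_adjoint, ← star_pow, star_eq_adjoint, adjoint_inner_right]

/-- On the orbit of u the (i, j) entry is Q^j Y^{i-j} with Q = T*T and Y = T*X, so the partial sums
are those of the Cauchy product of two geometric series. It is used for X = T and for X = T'. -/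
theorem tendsto_toeplitzForm_pow {T X : H →L[ℂ] H} (hT : IsQuasiNormal T)
    (hX : ∀ n, adjoint T ^ n * X ^ n = (adjoint T * X) ^ n)
    (hc : Commute (adjoint T * X) (adjoint T))
    (hcQ : Commute (adjoint T * T) (adjoint T * X))
    (hQ1 : ‖adjoint T * T‖ < 1) (hY1 : ‖adjoint T * X‖ < 1) (u : H) :
    Tendsto (fun L => toeplitzForm X (fun j => (T ^ j) u) L) atTop
      (nhds (2 * (inner ℂ u (((∑' n, (adjoint T * T) ^ n) *
          ∑' n, (adjoint T * X) ^ n) u)).re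
        - (inner ℂ u ((∑' n, (adjoint T * T) ^ n) u)).re)) := by
  set Q := adjoint T * T with hQ
  set Y := adjoint T * X with hY
  have hop : ∀ i, ∀ j ∈ range (i + 1), adjoint T ^ i * (X ^ (i - j) * T ^ j) = Q ^ j * Y ^ (i - j) := by
    intro i j hj
    obtain ⟨n, rfl⟩ := Nat.exists_eq_add_of_le (Nat.lt_succ_iff.mp (mem_range.mp hj))
    rw [Nat.add_sub_cancel_left, pow_add, mul_assoc, ← mul_assoc (adjoint T ^ n), hX,
      ← mul_assoc, ((hc.pow_left n).pow_right j).symm.eq, mul_assoc,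
      adjoint_pow_mul_pow_of_isQuasiNormal hT, ((hcQ.pow_left j).pow_right n).eq]
  have hform : ∀ L, toeplitzForm X (fun j => (T ^ j) u) L =
      2 * (inner ℂ u ((∑ i ∈ range L, ∑ j ∈ range (i + 1), Q ^ j * Y ^ (i - j)) u)).re
        - (inner ℂ u ((∑ i ∈ range L, Q ^ i) u)).re := by
    intro L
    rw [toeplitzForm, _root_.sum_apply, _root_.sum_apply, inner_sum, inner_sum,
      Complex.re_sum, Complex.re_sum, mul_sum, ← sum_sub_distrib]
    refine sum_congr rfl fun i _ => ?_
    congr 2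
    · rw [inner_pow_apply_left, map_sum, _root_.sum_apply, sum_congr rfl]
      intro j hj
      rw [← hop i j hj]
      rfl
    · rw [← re_inner_self_eq, inner_pow_apply_left,
        ← adjoint_pow_mul_pow_of_isQuasiNormal hT]
      rfl
  simp only [hform]
  have hsQ := summable_norm_geometric_of_norm_lt_one hQ1
  have hsY := summable_norm_geometric_of_norm_lt_one hY1
  have h1 := (hasSum_sum_range_mul_of_summable_norm hsQ hsY).tendsto_sum_nat
  have h2 := hsQ.of_norm.hasSum.tendsto_sum_nat
  have hcont : Continuous fun A : H →L[ℂ] H => (inner ℂ u (A u)).re := by fun_prop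
  exact (((hcont.tendsto _).comp h1).const_mul 2).sub ((hcont.tendsto _).comp h2)

theorem norm_mul_lt_one {A B : H →L[ℂ] H} (hA : ‖A‖ < 1) (hB : ‖B‖ < 1) : ‖A * B‖ < 1 :=
  (norm_mul_le A B).trans_lt (mul_lt_one_of_nonneg_of_lt_one_left (norm_nonneg _) hA hB.le)

theorem DoublyCommute.adjoint_commute {T T' : H →L[ℂ] H} (h : DoublyCommute T T') :
    Commute (adjoint T) T' := by
  have := Commute.star_star h.2
  rwa [star_eq_adjoint, star_eq_adjoint, adjoint_adjoint] at this

theorem DoublyCommute.commute_adjoint_mul {T T' : H →L[ℂ] H} (h : DoublyCommute T T')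
    (hT : IsQuasiNormal T) : Commute (adjoint T * T) (adjoint T * T') :=
  (hT.adjoint_commute).mul_right (h.adjoint_commute.mul_left h.1)

theorem norm_one_sub_apply_le {T T' : H →L[ℂ] H} (hT1 : ‖T‖ < 1) (hT1' : ‖T'‖ < 1) {c : ℝ}
    (hc : 1 ≤ c) (hd : DoublyCommute T T') (hT : IsQuasiNormal T)
    (h : ∀ h L, toeplitzForm T h L ≤ c * toeplitzForm T' h L) (x : H) :
    ‖(1 - adjoint T * T') x‖ ≤ 2 * c * ‖(1 - adjoint T * T) x‖ := by
  have hTa : ‖adjoint T‖ < 1 := by rwa [LinearIsometryEquiv.norm_map]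
  set Q := adjoint T * T with hQ
  set W := adjoint T * T' with hW
  have hQ1 : ‖Q‖ < 1 := norm_mul_lt_one hTa hT1
  have hW1 : ‖W‖ < 1 := norm_mul_lt_one hTa hT1'
  have hQW : Commute Q W := hd.commute_adjoint_mul hT
  have hcomm : Commute (1 - Q) (1 - W) :=
    (Commute.one_left _).sub_left ((Commute.one_right _).sub_right hQW)
  set v := (1 - W) x with hv
  -- This u cancels both resolvents: the limits become 2‖v‖² - ⟨u, v⟩ for T, which is at least ‖v‖²,
  -- and 2 Re⟨u, x⟩ - Re⟨u, v⟩ for T'.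
  set u := (1 - Q) v with hu
  have hself : ∀ a b : H, inner ℂ ((1 - Q) a) b = inner ℂ a ((1 - Q) b) := by
    intro a b
    simp only [hQ, sub_apply, one_apply_eq_self, mul_apply_eq_comp, inner_sub_left,
      inner_sub_right, adjoint_inner_left, adjoint_inner_right]
  have lim1 := tendsto_toeplitzForm_pow (X := T) hT (adjoint_pow_mul_pow_of_isQuasiNormal hT)
    hT.adjoint_commute (Commute.refl _) hQ1 hQ1 u
  have lim2 := tendsto_toeplitzForm_pow (X := T') hT (fun n => (hd.adjoint_commute.mul_pow n).symm)
    ((Commute.refl _).mul_left hd.adjoint_commute.symm) hQW hQ1 hW1 u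
  have hle := le_of_tendsto_of_tendsto' lim1 (lim2.const_mul c) fun L => h _ L
  rw [← hQ, ← hW] at hle
  set GQ := ∑' n, Q ^ n
  set GW := ∑' n, W ^ n
  have e1 : GQ u = v := by
    rw [hu, ← mul_apply_eq_comp, geom_series_mul_neg Q hQ1, one_apply_eq_self]
  have e2 : (GQ * GW) u = x := by
    have : GQ * GW * ((1 - Q) * (1 - W)) = 1 := by
      rw [hcomm.eq, mul_assoc, ← mul_assoc GW, geom_series_mul_neg W hW1, one_mul,
        geom_series_mul_neg Q hQ1]
    rw [hu, hv, ← mul_apply_eq_comp (1 - Q), ← mul_apply_eq_comp, this, one_apply_eq_self]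
  have e3 : (inner ℂ u ((GQ * GQ) u)).re = ‖v‖ ^ 2 := by
    rw [mul_apply_eq_comp, e1, hu, hself, ← mul_apply_eq_comp (1 - Q),
      mul_neg_geom_series Q hQ1, one_apply_eq_self, re_inner_self_eq]
  rw [e3, e1, e2] at hle
  have e4 : (inner ℂ u v).re ≤ ‖v‖ ^ 2 := by
    rw [hu, hself, re_inner_one_sub_adjoint_mul_self]
    exact sub_le_self _ (sq_nonneg _)
  -- Since 2x - v = (1 + W)x, the left side is Re⟨v, (1 + W)(1 - Q)x⟩, and ‖1 + W‖ ≤ 2.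
  have e5 : 2 * (inner ℂ u x).re - (inner ℂ u v).re ≤ ‖v‖ * (2 * ‖(1 - Q) x‖) := by
    have : 2 * (inner ℂ u x).re - (inner ℂ u v).re = (inner ℂ v ((1 + W) ((1 - Q) x))).re := by
      have hc2 : (1 + W) ((1 - Q) x) = (1 - Q) ((1 + W) x) := by
        rw [← mul_apply_eq_comp, ← mul_apply_eq_comp]
        congr 1
        exact ((Commute.one_right (1 - Q)).add_right
          ((Commute.one_left W).sub_left hQW)).symm.eq
      rw [hc2, ← hself, ← hu]
      have : (1 + W) x = x + x - v := by
        simp only [hv, add_apply, sub_apply, one_apply_eq_self]; abel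
      rw [this, inner_sub_right, inner_add_right, Complex.sub_re, Complex.add_re]
      ring
    rw [this]
    refine (re_inner_le_norm_mul _ _).trans (mul_le_mul_of_nonneg_left ?_ (norm_nonneg _))
    rw [add_apply, one_apply_eq_self]
    refine (norm_add_le _ _).trans ?_
    have := W.le_of_opNorm_le hW1.le ((1 - Q) x)
    linarith
  have e6 : ‖v‖ ^ 2 ≤ c * (‖v‖ * (2 * ‖(1 - Q) x‖)) := by
    have := mul_le_mul_of_nonneg_left e5 (zero_le_one.trans hc)
    linarith
  rcases (norm_nonneg v).eq_or_lt with h0 | h0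
  · rw [← h0]; positivity
  · nlinarith

theorem norm_inner_one_sub_apply_le {T T' : H →L[ℂ] H} (hT1 : ‖T‖ < 1) (hT1' : ‖T'‖ < 1) {c : ℝ}
    (hc : 1 ≤ c) (hd : DoublyCommute T T') (hT : IsQuasiNormal T)
    (h : ∀ h L, toeplitzForm T h L ≤ c * toeplitzForm T' h L) (x y : H) :
    ‖inner ℂ ((1 - adjoint T * T') x) y‖ ≤ 2 * c * ‖defectOp T x‖ * ‖defectOp T y‖ := by
  have hTa : ‖adjoint T‖ < 1 := by rwa [LinearIsometryEquiv.norm_map]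
  have hQ1 : ‖adjoint T * T‖ < 1 := norm_mul_lt_one hTa hT1
  -- For a strict contraction D_T is onto. With x = D_T g, one D_T moves to y and the previous bound
  -- applied to g produces D_T² g = D_T x.
  obtain ⟨g, rfl⟩ : ∃ g, defectOp T g = x :=
    ⟨defectOp T ((∑' n, (adjoint T * T) ^ n) x), by
      rw [← mul_apply_eq_comp, ← mul_apply_eq_comp, defectOp_mul_self hT1.le,
        mul_neg_geom_series _ hQ1, one_apply_eq_self]⟩
  have hDW : Commute (1 - adjoint T * T') (defectOp T) :=
    Commute.defectOp_right ((Commute.one_left _).sub_left (hd.commute_adjoint_mul hT).symm)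
  rw [← mul_apply_eq_comp, hDW.eq, mul_apply_eq_comp, defectOp_inner]
  refine (norm_inner_le_norm _ _).trans (mul_le_mul_of_nonneg_right ?_ (norm_nonneg _))
  refine (norm_one_sub_apply_le hT1 hT1' hc hd hT h g).trans_eq ?_
  rw [← defectOp_mul_self hT1.le, mul_apply_eq_comp]

theorem norm_inner_sub_apply_le {T T' : H →L[ℂ] H} (hT1 : ‖T‖ < 1) (hT1' : ‖T'‖ < 1) {c : ℝ}
    (hc : 1 ≤ c) (hd : DoublyCommute T T') (hT : IsQuasiNormal T)
    (h : ∀ h L, toeplitzForm T h L ≤ c * toeplitzForm T' h L) (x y : H) :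
    ‖inner ℂ ((T' - T) x) y‖ ≤ 4 * c * ‖defectOp T x‖ * ‖defectOp (adjoint T) y‖ := by
  have hTa : ‖adjoint T‖ < 1 := by rwa [LinearIsometryEquiv.norm_map]
  have key := norm_inner_one_sub_apply_le hT1 hT1' hc hd hT h
  set W := adjoint T * T' with hW
  have hW1 : ‖W‖ < 1 := norm_mul_lt_one hTa hT1'
  have hDW : Commute W (defectOp T) :=
    Commute.defectOp_right (hd.commute_adjoint_mul hT).symm
  -- The square is at most ‖x‖² - ‖Wx‖² = Re⟨(1 - W)x, (1 + W)x⟩ ≤ 4c ‖D_T x‖², and 4c ≤ (2c)²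
  -- because c ≥ 1.
  have h1 : ‖defectOp (adjoint T) (T' x)‖ ≤ 2 * c * ‖defectOp T x‖ := by
    have e1 : ‖defectOp (adjoint T) (T' x)‖ ^ 2 ≤ ‖x‖ ^ 2 - ‖W x‖ ^ 2 := by
      rw [norm_defectOp_sq hTa.le, hW, mul_apply_eq_comp]
      have := norm_sq_sub_nonneg hT1'.le x
      linarith
    have e2 : ‖x‖ ^ 2 - ‖W x‖ ^ 2 = (inner ℂ ((1 - W) x) (x + W x)).re := by
      rw [sub_apply, one_apply_eq_self, inner_sub_left, inner_add_right, inner_add_right]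
      simp only [Complex.sub_re, Complex.add_re, re_inner_self_eq, re_inner_comm (W x) x]
      ring
    have e3 : ‖defectOp T (x + W x)‖ ≤ 2 * ‖defectOp T x‖ := by
      rw [map_add, ← mul_apply_eq_comp (defectOp T) W, ← hDW.eq, mul_apply_eq_comp]
      refine (norm_add_le _ _).trans ?_
      have := W.le_of_opNorm_le hW1.le (defectOp T x)
      linarith
    have e4 := (Complex.re_le_norm _).trans (key x (x + W x))
    rw [← sq_le_sq₀ (norm_nonneg _) (by positivity)]
    have e5 : 2 * c * ‖defectOp T x‖ * ‖defectOp T (x + W x)‖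
        ≤ 2 * c * ‖defectOp T x‖ * (2 * ‖defectOp T x‖) :=
      mul_le_mul_of_nonneg_left e3 (by positivity)
    have e6 : 0 ≤ (c - 1) * c * ‖defectOp T x‖ ^ 2 :=
      mul_nonneg (mul_nonneg (by linarith) (by linarith)) (sq_nonneg _)
    nlinarith
  have h2 : ‖defectOp T (adjoint T y)‖ ≤ ‖defectOp (adjoint T) y‖ := by
    have := norm_defectOp_adjoint_apply_le hTa.le y
    rwa [adjoint_adjoint] at this
  -- T' - T = (1 - TT*)T' - T(1 - T*T'); each piece contributes 2c to the constant.
  have h3 : inner ℂ ((T' - T) x) y = inner ℂ (defectOp (adjoint T) (T' x)) (defectOp (adjoint T) y)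
      - inner ℂ ((1 - W) x) (adjoint T y) := by
    rw [defectOp_inner, defectOp_defectOp_apply hTa.le, adjoint_adjoint, adjoint_inner_right]
    simp only [hW, sub_apply, one_apply_eq_self, mul_apply_eq_comp, inner_sub_left,
      inner_sub_right, map_sub]
    rw [← adjoint_inner_left T (adjoint T y), ← adjoint_inner_right T (adjoint T (T' x))]
    ring
  rw [h3]
  refine (norm_sub_le _ _).trans ?_
  have h4 : ‖inner ℂ (defectOp (adjoint T) (T' x)) (defectOp (adjoint T) y)‖ ≤
      2 * c * ‖defectOp T x‖ * ‖defectOp (adjoint T) y‖ :=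
    (norm_inner_le_norm _ _).trans (mul_le_mul_of_nonneg_right h1 (norm_nonneg _))
  have h5 := (key x (adjoint T y)).trans (mul_le_mul_of_nonneg_left h2 (by positivity))
  linarith

end StrictContractions

/-! ### From the form estimate back to Harnack domination. -/

section HarnackOfForm

open Finset

variable {H : Type*} [NormedAddCommGroup H] [InnerProductSpace ℂ H] [CompleteSpace H]

/-- Expand ‖T'x‖² around Tx; the cross term is controlled by the hypothesis at y = Tx together with
‖D_{T*} T x‖ ≤ ‖D_T x‖. -/
theorem norm_defectOp_le_of_norm_inner_le {T T' : H →L[ℂ] H} (hT : ‖T‖ ≤ 1) (hT' : ‖T'‖ ≤ 1)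
    {C : ℝ} (hC : 0 ≤ C)
    (h : ∀ x y, ‖inner ℂ ((T' - T) x) y‖ ≤ C * ‖defectOp T x‖ * ‖defectOp (adjoint T) y‖) (x : H) :
    ‖defectOp T' x‖ ≤ (1 + 2 * C) * ‖defectOp T x‖ := by
  have e1 : ‖T' x‖ ^ 2 = ‖T x‖ ^ 2 + 2 * (inner ℂ ((T' - T) x) (T x)).re + ‖(T' - T) x‖ ^ 2 := by
    have : T' x = (T' - T) x + T x := by rw [sub_apply]; abel
    conv_lhs => rw [this]
    rw [norm_add_sq (𝕜 := ℂ)]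
    change _ + 2 * (inner ℂ ((T' - T) x) (T x)).re + _ = _
    ring
  have e2 : ‖inner ℂ ((T' - T) x) (T x)‖ ≤ C * ‖defectOp T x‖ * ‖defectOp T x‖ :=
    (h x (T x)).trans
      (mul_le_mul_of_nonneg_left (norm_defectOp_adjoint_apply_le hT x) (by positivity))
  have e3 := (abs_le.mp ((Complex.abs_re_le_norm _).trans e2)).1
  rw [← sq_le_sq₀ (norm_nonneg _) (by positivity), norm_defectOp_sq hT']
  have e4 := norm_defectOp_sq hT x
  have e5 : 0 ≤ (2 * C + 4 * C ^ 2) * ‖defectOp T x‖ ^ 2 := by positivity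
  nlinarith [sq_nonneg ‖(T' - T) x‖]

/-- Here k solves (1 - S*)k = D_S² f. Then S*(k - Sf) = k - f, whence D_{S*}(k - Sf) and D_S f have
equal norms; the remaining D_{S*} S f is no larger. -/
theorem norm_defectOp_adjoint_le_two_mul {S : H →L[ℂ] H} (hS : ‖S‖ ≤ 1) {f k : H}
    (h : k - adjoint S k = f - adjoint S (S f)) :
    ‖defectOp (adjoint S) k‖ ≤ 2 * ‖defectOp S f‖ := by
  have hS' : ‖adjoint S‖ ≤ 1 := by rwa [LinearIsometryEquiv.norm_map]
  have e1 : adjoint S (k - S f) = k - f := by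
    rw [map_sub]
    have : adjoint S k = k - (f - adjoint S (S f)) := by rw [← h]; abel
    rw [this]; abel
  have e2 : (inner ℂ k f).re - (inner ℂ k (S f)).re = ‖f‖ ^ 2 - ‖S f‖ ^ 2 := by
    have := congrArg (fun v => (inner ℂ v f).re) h
    simpa only [inner_sub_left, adjoint_inner_left, Complex.sub_re, re_inner_self_eq] using this
  have e3 : ‖defectOp (adjoint S) (k - S f)‖ = ‖defectOp S f‖ := by
    rw [← sq_eq_sq₀ (norm_nonneg _) (norm_nonneg _), norm_defectOp_sq hS', norm_defectOp_sq hS, e1,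
      norm_sub_sq_re, norm_sub_sq_re]
    linarith
  have e4 : k = (k - S f) + S f := by abel
  rw [e4, map_add]
  refine (norm_add_le _ _).trans ?_
  rw [e3]
  linarith [norm_defectOp_adjoint_apply_le hS f]

theorem exists_sub_apply_eq {A : H →L[ℂ] H} (hA : ‖A‖ < 1) (w : H) : ∃ f, f - A f = w :=
  ⟨(∑' n, A ^ n) w, by
    have := congrArg (fun B : H →L[ℂ] H => B w) (mul_neg_geom_series A hA)
    simpa using this⟩

theorem norm_smul_lt_one {T : H →L[ℂ] H} (hT : ‖T‖ ≤ 1) {z : ℂ} (hz : ‖z‖ < 1) : ‖z • T‖ < 1 := by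
  rw [norm_smul]
  exact (mul_le_of_le_one_right (norm_nonneg _) hT).trans_lt hz

theorem norm_defectOp_smul_sq {T : H →L[ℂ] H} (hT : ‖T‖ ≤ 1) {z : ℂ} (hz : ‖z‖ < 1) (x : H) :
    ‖defectOp (z • T) x‖ ^ 2 = (1 - ‖z‖ ^ 2) * ‖x‖ ^ 2 + ‖z‖ ^ 2 * ‖defectOp T x‖ ^ 2 := by
  rw [norm_defectOp_sq (norm_smul_lt_one hT hz).le, norm_defectOp_sq hT, smul_apply, norm_smul]
  ring

theorem norm_defectOp_le_smul {T : H →L[ℂ] H} (hT : ‖T‖ ≤ 1) {z : ℂ} (hz : ‖z‖ < 1) (x : H) :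
    ‖defectOp T x‖ ≤ ‖defectOp (z • T) x‖ := by
  rw [← sq_le_sq₀ (norm_nonneg _) (norm_nonneg _), norm_defectOp_smul_sq hT hz]
  have h1 : ‖defectOp T x‖ ^ 2 ≤ ‖x‖ ^ 2 :=
    pow_le_pow_left₀ (norm_nonneg _) (norm_defectOp_le hT x) 2
  have h2 : 0 ≤ 1 - ‖z‖ ^ 2 := by nlinarith [norm_nonneg z]
  nlinarith

/-- Comparison of Poisson kernels: the vectors `x`, `x'` are the resolvents of `T`, `T'` at the same
vector. -/
theorem norm_defectOp_resolvent_le {T T' : H →L[ℂ] H} (hT : ‖T‖ ≤ 1) (hT' : ‖T'‖ ≤ 1)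
    {C E : ℝ} (hC : 0 ≤ C) (hE : 1 ≤ E) (hDE : ∀ x, ‖defectOp T' x‖ ≤ E * ‖defectOp T x‖)
    (h : ∀ x y, ‖inner ℂ ((T' - T) x) y‖ ≤ C * ‖defectOp T x‖ * ‖defectOp (adjoint T') y‖)
    {z : ℂ} (hz : ‖z‖ < 1) {x x' : H} (hx : x - (z • T) x = x' - (z • T') x') :
    ‖defectOp (z • T') x'‖ ≤ (E + 2 * C) * ‖defectOp (z • T) x‖ := by
  have hTa : ‖adjoint T'‖ ≤ 1 := by rwa [LinearIsometryEquiv.norm_map]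
  have hS' := norm_smul_lt_one hT' hz
  have hSa : ‖adjoint (z • T')‖ < 1 := by rwa [LinearIsometryEquiv.norm_map]
  have hadj : adjoint (z • T') = (starRingEnd ℂ z) • adjoint T' := by
    rw [map_smulₛₗ]
  obtain ⟨f, hf⟩ : ∃ f, x' = x + f := ⟨x' - x, by abel⟩
  have hf' : f - (z • T') f = z • (T' - T) x := by
    rw [hf, map_add] at hx
    have : f - (z • T') f = (x + f - ((z • T') x + (z • T') f)) - (x - (z • T') x) := by abel
    rw [this, ← hx, sub_apply, smul_sub, smul_apply, smul_apply]
    abel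
  -- A dual vector: with S' = zT', ‖D_{S'} f‖² = ⟨(1 - S'*)k, f⟩ = ⟨k, (1 - S')f⟩ = ⟨k, z(T' - T)x⟩,
  -- to which the form estimate applies.
  obtain ⟨k, hk⟩ := exists_sub_apply_eq hSa (f - adjoint (z • T') ((z • T') f))
  have h1 := norm_defectOp_adjoint_le_two_mul hS'.le hk
  have h2 : ‖defectOp (z • T') x‖ ≤ E * ‖defectOp (z • T) x‖ := by
    rw [← sq_le_sq₀ (norm_nonneg _) (by positivity), mul_pow, norm_defectOp_smul_sq hT' hz,
      norm_defectOp_smul_sq hT hz]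
    have a1 : 0 ≤ 1 - ‖z‖ ^ 2 := by nlinarith [norm_nonneg z]
    have a2 : ‖defectOp T' x‖ ^ 2 ≤ E ^ 2 * ‖defectOp T x‖ ^ 2 := by
      rw [← mul_pow]
      exact pow_le_pow_left₀ (norm_nonneg _) (hDE x) 2
    have a3 : 1 ≤ E ^ 2 := by nlinarith
    have a4 : (1 - ‖z‖ ^ 2) * ‖x‖ ^ 2 ≤ E ^ 2 * ((1 - ‖z‖ ^ 2) * ‖x‖ ^ 2) :=
      le_mul_of_one_le_left (by positivity) a3
    have a5 := mul_le_mul_of_nonneg_left a2 (sq_nonneg ‖z‖)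
    linarith
  have h3 : ‖defectOp (z • T') f‖ ≤ 2 * C * ‖defectOp (z • T) x‖ := by
    have b1 : ‖defectOp (z • T') f‖ ^ 2 = (inner ℂ k (z • (T' - T) x)).re := by
      rw [norm_defectOp_sq hS'.le, ← hf', inner_sub_right, Complex.sub_re, ← adjoint_inner_left,
        ← Complex.sub_re, ← inner_sub_left, hk, inner_sub_left, adjoint_inner_left, Complex.sub_re,
        re_inner_self_eq, re_inner_self_eq]
    have b2 : (inner ℂ k (z • (T' - T) x)).re ≤ ‖inner ℂ ((T' - T) x) k‖ := by
      refine (Complex.re_le_norm _).trans ?_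
      rw [inner_smul_right, norm_mul, norm_inner_symm]
      exact mul_le_of_le_one_left (norm_nonneg _) hz.le
    have b3 : ‖inner ℂ ((T' - T) x) k‖ ≤
        C * ‖defectOp (z • T) x‖ * (2 * ‖defectOp (z • T') f‖) := by
      refine (h x k).trans ?_
      have c1 := norm_defectOp_le_smul hT hz x
      have c2 := norm_defectOp_le_smul hTa (z := starRingEnd ℂ z) (by simpa using hz) k
      rw [← hadj] at c2
      exact mul_le_mul (mul_le_mul_of_nonneg_left c1 hC) (c2.trans h1) (norm_nonneg _)
        (by positivity)
    rcases (norm_nonneg (defectOp (z • T') f)).eq_or_lt with h0 | h0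
    · rw [← h0]; positivity
    · nlinarith
  rw [hf, map_add]
  refine (norm_add_le _ _).trans ?_
  linarith

theorem norm_inner_pow_le {H : Type*} [NormedAddCommGroup H] [InnerProductSpace ℂ H] {T : H →L[ℂ] H}
    (hT : ‖T‖ ≤ 1) (n : ℕ) (x : H) :
    ‖inner ℂ x ((T ^ n) x)‖ ≤ ‖x‖ ^ 2 := by
  have h1 : ‖T ^ n‖ ≤ 1 := by
    rcases n.eq_zero_or_pos with rfl | hn
    · exact norm_id_le
    · exact (norm_pow_le' T hn).trans (pow_le_one₀ (norm_nonneg _) hT)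
  refine (norm_inner_le_norm _ _).trans ?_
  rw [sq]
  refine mul_le_mul_of_nonneg_left ?_ (norm_nonneg _)
  simpa using (T ^ n).le_of_opNorm_le h1 x

/-- With y = (1 - zT)⁻¹x, the operator Poisson kernel at x is the squared defect norm ‖D_{zT} y‖²,
so Poisson kernels can be compared through resolvents. -/
theorem exists_resolvent_hasSum {T : H →L[ℂ] H} (hT : ‖T‖ ≤ 1) {z : ℂ} (hz : ‖z‖ < 1) (x : H) :
    ∃ y, x = y - (z • T) y ∧ HasSum (fun n => z ^ n * inner ℂ x ((T ^ n) x)) (inner ℂ x y) ∧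
      2 * (inner ℂ x y).re - ‖x‖ ^ 2 = ‖defectOp (z • T) y‖ ^ 2 := by
  have hS := norm_smul_lt_one hT hz
  have hs := (summable_geometric_of_norm_lt_one hS).hasSum
  set G := ∑' n, (z • T) ^ n with hG
  have hx : x = G x - (z • T) (G x) := by
    have := congrArg (fun B : H →L[ℂ] H => B x) (mul_neg_geom_series (z • T) hS)
    simpa using this.symm
  refine ⟨G x, hx, ?_, ?_⟩
  · have h1 := hs.mapL (ContinuousLinearMap.apply ℂ H x)
    have h2 := h1.mapL (innerSL ℂ x)
    simpa [smul_pow, inner_smul_right] using h2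
  · rw [norm_defectOp_sq hS.le]
    set y := G x
    conv_lhs => rw [hx]
    rw [norm_sub_sq_re, inner_sub_left, Complex.sub_re, re_inner_self_eq,
      re_inner_comm ((z • T) y) y]
    ring

theorem harnackDominated_of_norm_inner_le {T T' : H →L[ℂ] H} (hT : ‖T‖ ≤ 1) (hT' : ‖T'‖ ≤ 1)
    {C E : ℝ} (hC : 0 ≤ C) (hE : 1 ≤ E) (hDE : ∀ x, ‖defectOp T' x‖ ≤ E * ‖defectOp T x‖)
    (h : ∀ x y, ‖inner ℂ ((T' - T) x) y‖ ≤ C * ‖defectOp T x‖ * ‖defectOp (adjoint T') y‖) :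
    HarnackDominated T' T := by
  set K := (E + 2 * C) ^ 2 with hK
  have hK1 : 1 ≤ K := one_le_pow₀ (by linarith)
  refine ⟨K, hK1, fun p hp => ?_⟩
  rw [realPart_le_smul_realPart_iff]
  intro x
  -- The Poisson sum of t is K ‖D_{zT} y‖² - ‖D_{zT'} y'‖², nonnegative by the resolvent comparison.
  let t : ℕ → ℂ := fun n => K * inner ℂ x ((T ^ n) x) - inner ℂ x ((T' ^ n) x)
  have ht0 : t 0 = ((K * ‖x‖ ^ 2 - ‖x‖ ^ 2 : ℝ) : ℂ) := by
    simp only [t, pow_zero, one_apply_eq_self]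
    rw [inner_self_eq_norm_sq_to_K]
    push_cast
    rfl
  have hmain := re_sum_coeff_mul_nonneg (t := t) (B := K * ‖x‖ ^ 2 + ‖x‖ ^ 2) (fun n => by
      refine (norm_sub_le _ _).trans (add_le_add ?_ (norm_inner_pow_le hT' n x))
      rw [norm_mul, Complex.norm_real, Real.norm_of_nonneg (by linarith)]
      exact mul_le_mul_of_nonneg_left (norm_inner_pow_le hT n x) (by linarith))
    (by rw [ht0, Complex.ofReal_im]) (fun z hz s hs => by
      obtain ⟨y, hy, hsum, hval⟩ := exists_resolvent_hasSum hT hz x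
      obtain ⟨y', hy', hsum', hval'⟩ := exists_resolvent_hasSum hT' hz x
      have hs' : s = K * inner ℂ x y - inner ℂ x y' := by
        refine hs.unique ?_
        have := (hsum.mul_left (K : ℂ)).sub hsum'
        refine this.congr_fun ?_
        intro n
        simp only [t]
        ring
      have hle := norm_defectOp_resolvent_le hT hT' hC hE hDE h hz (hy.symm.trans hy')
      have hle2 := pow_le_pow_left₀ (norm_nonneg _) hle 2
      rw [mul_pow, ← hK, ← hval, ← hval'] at hle2
      rw [hs', ht0, Complex.sub_re, Complex.ofReal_re]
      simp only [Complex.mul_re, Complex.sub_re, Complex.re_ofNat, Complex.im_ofNat, zero_mul,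
        sub_zero, Complex.ofReal_re, Complex.ofReal_im]
      linarith) p hp
  have hexp : ∀ S : H →L[ℂ] H, inner ℂ x (Polynomial.aeval S p x) =
      ∑ n ∈ range (p.natDegree + 1), p.coeff n * inner ℂ x ((S ^ n) x) := by
    intro S
    rw [Polynomial.aeval_eq_sum_range, _root_.sum_apply, inner_sum]
    exact sum_congr rfl fun n _ => by rw [smul_apply, inner_smul_right]
  have hfin : ∑ n ∈ range (p.natDegree + 1), p.coeff n * t n =
      K * inner ℂ x (Polynomial.aeval T p x) - inner ℂ x (Polynomial.aeval T' p x) := by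
    rw [hexp, hexp, mul_sum, ← sum_sub_distrib]
    exact sum_congr rfl fun n _ => by simp only [t]; ring
  rw [hfin, Complex.sub_re, Complex.re_ofReal_mul] at hmain
  linarith

end HarnackOfForm

/-! ### Letting r tend to 1 and assembling the equivalences. -/

section Main

variable {H : Type*} [NormedAddCommGroup H] [InnerProductSpace ℂ H] [CompleteSpace H]

theorem adjoint_ofReal_smul (r : ℝ) (T : H →L[ℂ] H) :
    adjoint ((r : ℂ) • T) = (r : ℂ) • adjoint T := by
  rw [map_smulₛₗ, Complex.conj_ofReal]

theorem DoublyCommute.ofReal_smul {T T' : H →L[ℂ] H} (h : DoublyCommute T T') (r : ℝ) :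
    DoublyCommute ((r : ℂ) • T) ((r : ℂ) • T') := by
  refine ⟨(h.1.smul_left _).smul_right _, ?_⟩
  rw [adjoint_ofReal_smul]
  exact (h.2.smul_left _).smul_right _

theorem IsQuasiNormal.ofReal_smul {T : H →L[ℂ] H} (h : IsQuasiNormal T) (r : ℝ) :
    IsQuasiNormal ((r : ℂ) • T) := by
  rw [IsQuasiNormal, adjoint_ofReal_smul, smul_mul_smul_comm]
  exact Commute.smul_right (Commute.smul_left h _) _

theorem norm_ofReal_smul_apply_sq {H : Type*} [NormedAddCommGroup H] [InnerProductSpace ℂ H] (r : ℝ)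
    (A : H →L[ℂ] H) (x : H) :
    ‖((r : ℂ) • A) x‖ ^ 2 = r ^ 2 * ‖A x‖ ^ 2 := by
  rw [smul_apply, norm_smul, mul_pow, Complex.norm_real, Real.norm_eq_abs, sq_abs]

theorem norm_defectOp_le_mul_of_sq_le {A B : H →L[ℂ] H} (hA : ‖A‖ ≤ 1) (hB : ‖B‖ ≤ 1) {c : ℝ}
    (hc : 1 ≤ c) {x : H} (h : ‖x‖ ^ 2 - ‖A x‖ ^ 2 ≤ c * (‖x‖ ^ 2 - ‖B x‖ ^ 2)) :
    ‖defectOp A x‖ ≤ c * ‖defectOp B x‖ := by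
  rw [← norm_defectOp_sq hA, ← norm_defectOp_sq hB] at h
  rw [← sq_le_sq₀ (norm_nonneg _) (by positivity), mul_pow]
  exact h.trans (mul_le_mul_of_nonneg_right (by nlinarith) (sq_nonneg _))

theorem shmulyanEquivalent_and_harnackEquivalent {T T' : H →L[ℂ] H} (hT : ‖T‖ ≤ 1)
    (hT' : ‖T'‖ ≤ 1) (hd : DoublyCommute T T') (hq : IsQuasiNormal T)
    (hH : HarnackDominated T T') : ShmulyanEquivalent T T' ∧ HarnackEquivalent T T' := by
  have hTa : ‖adjoint T‖ ≤ 1 := by rwa [LinearIsometryEquiv.norm_map]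
  have hTa' : ‖adjoint T'‖ ≤ 1 := by rwa [LinearIsometryEquiv.norm_map]
  obtain ⟨c, hc1, hc⟩ := id hH
  have hc0 : 0 ≤ c := zero_le_one.trans hc1
  have htoep : ∀ r : ℝ, 0 < r → r < 1 → ∀ h L,
      toeplitzForm ((r : ℂ) • T) h L ≤ c * toeplitzForm ((r : ℂ) • T') h L :=
    fun r h0 h1 h L => toeplitzForm_le
      (fun p hp => (realPart_le_smul_realPart_iff _ _ _).mp (hc p hp)) h0 h1 h L
  have hnorm : ∀ A : H →L[ℂ] H, ‖A‖ ≤ 1 → ∀ r : ℝ, 0 < r → r < 1 → ‖(r : ℂ) • A‖ < 1 := by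
    intro A hA r h0 h1
    exact norm_smul_lt_one hA (by rwa [Complex.norm_real, Real.norm_of_nonneg h0.le])
  have hD : ∀ x, ‖defectOp T x‖ ≤ c * ‖defectOp T' x‖ := by
    intro x
    refine norm_defectOp_le_mul_of_sq_le hT hT' hc1 ?_
    have := continuous_le_of_lt_one (f := fun r => ‖x‖ ^ 2 - r ^ 2 * ‖T x‖ ^ 2)
      (g := fun r => c * (‖x‖ ^ 2 - r ^ 2 * ‖T' x‖ ^ 2)) (by fun_prop) (by fun_prop)
      fun r h0 h1 => by
        have := defect_add_sub_le_of_toeplitzForm_le (htoep r h0 h1) x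
        rw [norm_ofReal_smul_apply_sq, norm_ofReal_smul_apply_sq] at this
        exact (le_add_of_nonneg_right (sq_nonneg _)).trans this
    simpa using this
  have hDa : ∀ x, ‖defectOp (adjoint T) x‖ ≤ c * ‖defectOp (adjoint T') x‖ := by
    intro x
    refine norm_defectOp_le_mul_of_sq_le hTa hTa' hc1 ?_
    have := continuous_le_of_lt_one (f := fun r => ‖x‖ ^ 2 - r ^ 2 * ‖adjoint T x‖ ^ 2)
      (g := fun r => c * (‖x‖ ^ 2 - r ^ 2 * ‖adjoint T' x‖ ^ 2)) (by fun_prop) (by fun_prop)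
      fun r h0 h1 => by
        have := adjoint_defect_add_sub_le_of_toeplitzForm_le (htoep r h0 h1) x
        rw [adjoint_ofReal_smul, adjoint_ofReal_smul, norm_ofReal_smul_apply_sq,
          norm_ofReal_smul_apply_sq] at this
        exact (le_add_of_nonneg_right (sq_nonneg _)).trans this
    simpa using this
  have hform : ∀ x y, ‖inner ℂ ((T' - T) x) y‖ ≤
      4 * c * ‖defectOp T x‖ * ‖defectOp (adjoint T) y‖ := by
    intro x y
    rw [← sq_le_sq₀ (norm_nonneg _) (by positivity), mul_pow, mul_pow, norm_defectOp_sq hT,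
      norm_defectOp_sq hTa]
    -- After squaring, the defects of rT are polynomial in r, so the limit needs no continuity of
    -- the square root.
    have := continuous_le_of_lt_one (f := fun r => r ^ 2 * ‖inner ℂ ((T' - T) x) y‖ ^ 2)
      (g := fun r => (4 * c) ^ 2 * (‖x‖ ^ 2 - r ^ 2 * ‖T x‖ ^ 2) *
        (‖y‖ ^ 2 - r ^ 2 * ‖adjoint T y‖ ^ 2)) (by fun_prop) (by fun_prop)
      fun r h0 h1 => by
        have hr := hnorm T hT r h0 h1
        have hra : ‖(r : ℂ) • adjoint T‖ ≤ 1 := (hnorm _ hTa r h0 h1).le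
        have := pow_le_pow_left₀ (norm_nonneg _) (norm_inner_sub_apply_le hr (hnorm T' hT' r h0 h1)
          hc1 (hd.ofReal_smul r) (hq.ofReal_smul r) (htoep r h0 h1) x y) 2
        rw [mul_pow, mul_pow, norm_defectOp_sq hr.le, adjoint_ofReal_smul, norm_defectOp_sq hra,
          norm_ofReal_smul_apply_sq, norm_ofReal_smul_apply_sq, ← smul_sub, smul_apply,
          inner_smul_left, norm_mul, mul_pow, Complex.conj_ofReal, Complex.norm_real,
          Real.norm_eq_abs, sq_abs] at this
        exact this
    simpa using this
  have hform' : ∀ x y, ‖inner ℂ ((T - T') x) y‖ ≤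
      4 * c * c * c * ‖defectOp T' x‖ * ‖defectOp (adjoint T') y‖ := by
    intro x y
    have e : (T - T') x = -((T' - T) x) := by simp
    rw [e, inner_neg_left, norm_neg]
    refine (hform x y).trans ?_
    calc _ ≤ 4 * c * (c * ‖defectOp T' x‖) * (c * ‖defectOp (adjoint T') y‖) := by
          gcongr
          · exact hD x
          · exact hDa y
      _ = _ := by ring
  have hmix : ∀ x y, ‖inner ℂ ((T' - T) x) y‖ ≤
      4 * c * c * ‖defectOp T x‖ * ‖defectOp (adjoint T') y‖ := by
    intro x y
    refine (hform x y).trans ?_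
    calc _ ≤ 4 * c * ‖defectOp T x‖ * (c * ‖defectOp (adjoint T') y‖) := by
          gcongr
          exact hDa y
      _ = _ := by ring
  exact ⟨⟨shmulyanDominated_of_norm_inner_le hT' (by positivity) hform',
      shmulyanDominated_of_norm_inner_le hT (by positivity) hform⟩,
    hH, harnackDominated_of_norm_inner_le hT hT' (by positivity) (by linarith)
      (norm_defectOp_le_of_norm_inner_le hT hT' (by positivity) hform) hmix⟩

end Main

theorem mainTheorem2 {H : Type*} [NormedAddCommGroup H] [InnerProductSpace ℂ H] [CompleteSpace H] :
    (∀ T T' : H →L[ℂ] H, ‖T‖ ≤ 1 → ‖T'‖ ≤ 1 → DoublyCommute T T' → IsQuasiNormal T →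
      HarnackDominated T T' → ShmulyanEquivalent T T' ∧ HarnackEquivalent T T') ∧
    (∀ T T' : H →L[ℂ] H, ‖T‖ ≤ 1 → ‖T'‖ ≤ 1 → Commute T T' → IsStarNormal T → IsStarNormal T' →
      HarnackDominated T T' → ShmulyanEquivalent T T' ∧ HarnackEquivalent T T') := by
  refine ⟨fun T T' hT hT' hd hq hH => shmulyanEquivalent_and_harnackEquivalent hT hT' hd hq hH,
    -- Fuglede's theorem for the normal T' turns commutation into double commutation.
    fun T T' hT hT' hcomm hn hn' hH =>
      shmulyanEquivalent_and_harnackEquivalent hT hT' ⟨hcomm, hn'.commute_star_right hcomm⟩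
        ?_ hH⟩
  exact (hn.star_comm_self.symm).mul_right (Commute.refl T)
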